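/- Let $p\in[1,\infty)$. Write $M_d^p$ for the algebra $M_d(\mathbb{C})\cong\mathcal{B}(\ell^p(\{1,\dots,d\}))$ with its operator norm, and equip finite direct sums of such algebras with componentwise operations and the maximum norm. An idempotent $e$ in a unital complex Banach algebra is called \emph{hermitian} if $\|\exp(i\lambda e)\|\le 1$ for all $\lambda\in\mathbb{R}$. A \emph{spatial $L^p$-AF-direct system} is a direct system $((A_i)_{i\in I},(\varphi_{j,i})_{i\le j})$ over a (nonempty) directed set $I$ in which every $A_i$ is a finite direct sum $\bigoplus_k M_{d_{i,k}}^p$ and every $\varphi_{j,i}\colon A_i\to A_j$ is a contractive (not necessarily unital or injective) homomorphism of complex algebras taking the identity of each summand $M_{d_{i,k}}^p$ to a hermitian idempotent of $A_j$. A \emph{spatial $L^p$-AF-algebra} is a complex Banach algebra that is isometrically isomorphic to the direct limit of such a system, that is, to the Hausdorff completion of the algebraic direct limit with respect to the seminorm sending the class of $a\in A_i$ to $\inf_{j\ge i}\|\varphi_{j,i}(a)\|$. Let $A$ be a spatial $L^p$-AF-algebra. Then $A$ is \emph{$p$-incompressible}: for every $L^p$-space $\mathcal{E}$ (a Banach space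 isometrically isomorphic to the complex space $L^p(X,\mu)$ of some measure space $(X,\mu)$), every contractive, injective homomorphism of complex algebras $\varphi\colon A\to\mathcal{B}(\mathcal{E})$ is isometric. -/

import Mathlib

open MeasureTheory
open scoped ENNReal

universe u v w x

noncomputable section

namespace LpAF

/-- The matrix algebra `M_n^p`: the algebra of `n × n` complex matrices, realised as the algebra
`B(ℓ^p_n)` of (bounded) operators on `ℓ^p({1, …, n})`, with the operator norm (the spatial norm). -/
abbrev SpatialMatrix (p : ℝ≥0∞) [Fact (1 ≤ p)] (n : ℕ) : Type :=
  PiLp p (fun _ : Fin n => ℂ) →L[ℂ] PiLp p (fun _ : Fin n => ℂ)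

/-- The finite direct sum `⨁ₖ M_{d k}^p`, with componentwise operations and the maximum norm. -/
abbrev SpatialSum (p : ℝ≥0∞) [Fact (1 ≤ p)] {m : ℕ} (d : Fin m → ℕ) : Type :=
  ∀ k : Fin m, SpatialMatrix p (d k)

/-- A hermitian idempotent in a unital complex Banach algebra: an idempotent `e` with
`‖exp (i t e)‖ ≤ 1` for all real `t`. -/
def IsHermitianIdempotent {B : Type*} [NormedRing B] [NormedAlgebra ℂ B] (e : B) : Prop :=
  IsIdempotentElem e ∧
    ∀ t : ℝ, ‖NormedSpace.exp ((Complex.I * (t : ℂ)) • e)‖ ≤ 1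

/-- A spatial `L^p`-AF-direct system over `I`: the algebras `A_i = ⨁ₖ M_{d i k}^p` (all matrix
sizes being positive), with contractive, not necessarily unital or injective, connecting
homomorphisms that send the identity of each matrix block to a hermitian idempotent. -/
structure SpatialAFSystem (p : ℝ≥0∞) [Fact (1 ≤ p)] (I : Type v) [Preorder I] where
  blocks : I → ℕ
  size : ∀ i, Fin (blocks i) → ℕ
  size_pos : ∀ i k, 0 < size i k
  map : ∀ ⦃i j : I⦄, i ≤ j → SpatialSum p (size i) →ₙₐ[ℂ] SpatialSum p (size j)
  map_refl : ∀ (i : I) (a : SpatialSum p (size i)), map (le_refl i) a = a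
  map_trans : ∀ ⦃i j k : I⦄ (hij : i ≤ j) (hjk : j ≤ k) (a : SpatialSum p (size i)),
    map hjk (map hij a) = map (hij.trans hjk) a
  contractive : ∀ ⦃i j : I⦄ (hij : i ≤ j) (a : SpatialSum p (size i)), ‖map hij a‖ ≤ ‖a‖
  hermitian : ∀ ⦃i j : I⦄ (hij : i ≤ j) (k : Fin (blocks i)),
    IsHermitianIdempotent (map hij (Pi.single k 1))

/-- The Banach algebra `A`, with the homomorphisms `ψ i : B i → A`, is the direct limit of the
system `(B, φ)` of normed algebras with contractive connecting maps over a directed set, that is,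
it is the Hausdorff completion of the algebraic direct limit for the seminorm that sends
the class of `a ∈ B i` to `lim_j ‖φ_{j,i} a‖ = inf_{j ≥ i} ‖φ_{j,i} a‖`. -/
structure IsBanachDirectLimit {I : Type v} [Preorder I] {B : I → Type w}
    [∀ i, NonUnitalNormedRing (B i)] [∀ i, NormedSpace ℂ (B i)]
    (φ : ∀ ⦃i j : I⦄, i ≤ j → B i →ₙₐ[ℂ] B j)
    {A : Type u} [NonUnitalNormedRing A] [NormedSpace ℂ A]
    (ψ : ∀ i, B i →ₙₐ[ℂ] A) : Prop where
  complete : CompleteSpace A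
  compatible : ∀ ⦃i j : I⦄ (hij : i ≤ j) (a : B i), ψ j (φ hij a) = ψ i a
  norm_eq : ∀ (i : I) (a : B i), ‖ψ i a‖ = ⨅ j : Set.Ici i, ‖φ j.2 a‖
  dense : Dense (⋃ i, Set.range (ψ i))

/-- `A` is a spatial `L^p`-AF-algebra: it is (isometrically isomorphic to) the direct limit of a
spatial `L^p`-AF-direct system over some nonempty directed index set. -/
def IsSpatialLpAFAlgebra (p : ℝ≥0∞) [Fact (1 ≤ p)]
    (A : Type u) [NonUnitalNormedRing A] [NormedSpace ℂ A] : Prop :=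
  ∃ (I : Type v) (_ : Preorder I) (_ : Nonempty I) (_ : IsDirectedOrder I)
    (S : SpatialAFSystem p I) (ψ : ∀ i, SpatialSum p (S.size i) →ₙₐ[ℂ] A),
    IsBanachDirectLimit S.map ψ

/-- `E` is an `L^p`-space: it is isometrically isomorphic to `L^p(X, μ)` for a measure space
`(X, μ)`. -/
def IsLpSpace (p : ℝ≥0∞) [Fact (1 ≤ p)] (E : Type u) [NormedAddCommGroup E] [NormedSpace ℂ E] :
    Prop :=
  ∃ (X : Type v) (_ : MeasurableSpace X) (μ : Measure X), Nonempty (E ≃ₗᵢ[ℂ] Lp ℂ p μ)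

/-- `A` is `p`-incompressible: for every `L^p`-space `E`, every contractive, injective (not
necessarily unital) homomorphism `A → B(E)` of complex algebras is isometric. -/
def IsPIncompressible (p : ℝ≥0∞) [Fact (1 ≤ p)]
    (A : Type u) [NonUnitalNormedRing A] [NormedSpace ℂ A] : Prop :=
  ∀ (E : Type v) [NormedAddCommGroup E] [NormedSpace ℂ E], IsLpSpace.{v, w} p E →
    ∀ φ : A →ₙₐ[ℂ] (E →L[ℂ] E), (∀ a, ‖φ a‖ ≤ ‖a‖) → Function.Injective φ → Isometry φ

end LpAF

end

namespace LpAF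

/-! A contractive homomorphism out of a finite sum of operator algebras cannot shrink a block it
does not kill. Sandwiching `a k` between rank-one operators of controlled norm gives a multiple of a
rank-one idempotent, whose nonzero image has norm at least one (`norm_apply_le_of_rankOne_ne_zero`).
Hence `‖ψ a‖` and `‖φ (ψ a)‖` both equal the largest `‖a k‖` over surviving blocks, and injectivity
of `φ` makes these the same blocks. Density of the finite stages finishes the proof. -/

/-- A nonzero idempotent in a normed ring has norm at least one. -/
theorem one_le_norm_of_isIdempotentElem {B : Type*} [NonUnitalNormedRing B] {e : B}
    (he : IsIdempotentElem e) (h0 : e ≠ 0) : 1 ≤ ‖e‖ := by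
  have h := norm_mul_le e e
  rw [he.eq] at h
  have hpos := norm_pos_iff.mpr h0
  nlinarith

section OperatorSums

variable {ι : Type*} [DecidableEq ι] {V : ι → Type*}
  [∀ k, NormedAddCommGroup (V k)] [∀ k, NormedSpace ℂ (V k)]

/-- The identity of a finite-dimensional normed space is a sum of rank-one operators, so an
additive map that kills all rank-one operators of a block kills the unit of the block. -/
theorem exists_rankOne_ne_zero {B : Type*} [AddCommMonoid B]
    (k : ι) [FiniteDimensional ℂ (V k)] (θ : (∀ k, V k →L[ℂ] V k) →+ B)
    (h : θ (Pi.single k 1) ≠ 0) :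
    ∃ (f : V k →L[ℂ] ℂ) (v : V k), θ (Pi.single k (f.smulRight v)) ≠ 0 := by
  by_contra! hzero
  apply h
  let b := Module.finBasis ℂ (V k)
  have hone : (1 : V k →L[ℂ] V k) =
      ∑ j, (LinearMap.toContinuousLinearMap (b.coord j)).smulRight (b j) := by
    ext x
    simp [b.sum_repr]
  rw [hone, ← AddMonoidHom.single_apply, map_sum, map_sum]
  exact Finset.sum_eq_zero fun j _ => hzero _ _

variable [Fintype ι]

/-- A contractive homomorphism from a finite direct sum of algebras of operators that does not
vanish on some rank-one operator of a block does not decrease the norm of the component in that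
block. -/
theorem norm_apply_le_of_rankOne_ne_zero {B : Type*} [NonUnitalNormedRing B] [NormedSpace ℂ B]
    (θ : (∀ k, V k →L[ℂ] V k) →ₙₐ[ℂ] B) (hθ : ∀ a, ‖θ a‖ ≤ ‖a‖)
    (k : ι) (f : V k →L[ℂ] ℂ) (v : V k) (hfv : θ (Pi.single k (f.smulRight v)) ≠ 0)
    (a : ∀ k, V k →L[ℂ] V k) : ‖a k‖ ≤ ‖θ a‖ := by
  have hv : v ≠ 0 := by
    rintro rfl
    exact hfv (by simp)
  have hv' : 0 < ‖v‖ := norm_pos_iff.mpr hv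
  have hvC : (‖v‖ : ℂ) ≠ 0 := by exact_mod_cast hv'.ne'
  obtain ⟨g, hg, hgv⟩ := exists_dual_vector'' ℂ v
  replace hgv : g v = (‖v‖ : ℂ) := hgv
  -- A projection onto the line of `v`. It fixes every rank-one operator with range in that line
  -- from the left, so `θ` cannot kill it.
  let e : V k →L[ℂ] V k := (‖v‖ : ℂ)⁻¹ • g.smulRight v
  have hev : e v = v := by
    change (‖v‖ : ℂ)⁻¹ • g v • v = v
    rw [hgv, inv_smul_smul₀ hvC]
  have hef (h : V k →L[ℂ] ℂ) : e * h.smulRight v = h.smulRight v := by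
    ext x
    change e (h x • v) = h x • v
    rw [map_smul, hev]
  have he : e * e = e := by
    change e * ((‖v‖ : ℂ)⁻¹ • g.smulRight v) = (‖v‖ : ℂ)⁻¹ • g.smulRight v
    rw [mul_smul_comm, hef]
  have hθe0 : θ (Pi.single k e) ≠ 0 := by
    intro h0
    apply hfv
    rw [← hef f, Pi.single_mul, map_mul, h0, zero_mul]
  have hθe : 1 ≤ ‖θ (Pi.single k e)‖ := by
    refine one_le_norm_of_isIdempotentElem ?_ hθe0
    rw [IsIdempotentElem, ← map_mul, ← Pi.single_mul, he]
  refine ContinuousLinearMap.opNorm_le_bound _ (norm_nonneg _) fun x => ?_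
  obtain ⟨β, hβ, hβx⟩ := exists_dual_vector'' ℂ (a k x)
  replace hβx : β (a k x) = (‖a k x‖ : ℂ) := hβx
  -- The right factor sends `v` to `‖v‖ • x`, and `β` norms `a k x`; the outer factors have norm at
  -- most `‖x‖` and `‖v‖`, so `‖v‖` cancels at the end.
  have key : (Pi.single k (β.smulRight v) * a * Pi.single k (g.smulRight x) :
      ∀ k, V k →L[ℂ] V k) = ((‖a k x‖ * ‖v‖ : ℝ) : ℂ) • Pi.single k e := by
    rw [← Pi.single_mul_left, ← Pi.single_mul, ← Pi.single_smul]
    congr 1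
    ext y
    change β (a k (g y • x)) • v = ((‖a k x‖ * ‖v‖ : ℝ) : ℂ) • (‖v‖ : ℂ)⁻¹ • g y • v
    rw [map_smul, map_smul, hβx, smul_smul, smul_smul, smul_eq_mul, Complex.ofReal_mul]
    congr 1
    field_simp
  have hβ' : ‖θ (Pi.single k (β.smulRight v))‖ ≤ ‖v‖ := by
    refine (hθ _).trans ?_
    rw [Pi.norm_single, ContinuousLinearMap.norm_smulRight_apply]
    nlinarith
  have hx' : ‖θ (Pi.single k (g.smulRight x))‖ ≤ ‖x‖ := by
    refine (hθ _).trans ?_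
    rw [Pi.norm_single, ContinuousLinearMap.norm_smulRight_apply]
    nlinarith [norm_nonneg x]
  have hle : ‖a k x‖ * ‖v‖ ≤ ‖v‖ * ‖θ a‖ * ‖x‖ := by
    calc ‖a k x‖ * ‖v‖ ≤ ‖a k x‖ * ‖v‖ * ‖θ (Pi.single k e)‖ :=
          le_mul_of_one_le_right (by positivity) hθe
      _ = ‖θ (Pi.single k (β.smulRight v) * a * Pi.single k (g.smulRight x))‖ := by
          rw [key, map_smul, norm_smul, Complex.norm_real, Real.norm_of_nonneg (by positivity)]
      _ ≤ ‖θ (Pi.single k (β.smulRight v))‖ * ‖θ a‖ * ‖θ (Pi.single k (g.smulRight x))‖ := by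
          rw [map_mul, map_mul]
          exact (norm_mul_le _ _).trans (by gcongr; exact norm_mul_le _ _)
      _ ≤ ‖v‖ * ‖θ a‖ * ‖x‖ := by gcongr
  refine le_of_mul_le_mul_right ?_ hv'
  linarith

/-- If `ψ` and `φ ∘ ψ` are contractive homomorphisms defined on a finite direct sum of algebras of
operators on finite-dimensional spaces and `φ` is injective, then `φ` does not decrease the norm
on the range of `ψ`. -/
theorem norm_le_norm_comp_of_injective [∀ k, FiniteDimensional ℂ (V k)]
    {A B : Type*} [NonUnitalNormedRing A] [NormedSpace ℂ A]
    [NonUnitalNormedRing B] [NormedSpace ℂ B]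
    (ψ : (∀ k, V k →L[ℂ] V k) →ₙₐ[ℂ] A) (hψ : ∀ a, ‖ψ a‖ ≤ ‖a‖)
    (φ : A →ₙₐ[ℂ] B) (hφ : Function.Injective φ) (hφψ : ∀ a, ‖φ (ψ a)‖ ≤ ‖a‖)
    (a : ∀ k, V k →L[ℂ] V k) : ‖ψ a‖ ≤ ‖φ (ψ a)‖ := by
  classical
  -- Blocks killed by `ψ` may make `‖a‖` too large; discarding them leaves `ψ a` unchanged.
  let u : ∀ k, V k →L[ℂ] V k := fun k => if ψ (Pi.single k 1) = 0 then 0 else a k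
  have hu : ψ a = ψ u := by
    rw [← Finset.univ_sum_single a, ← Finset.univ_sum_single u, map_sum, map_sum]
    refine Finset.sum_congr rfl fun k _ => ?_
    by_cases hk : ψ (Pi.single k 1) = 0
    · rw [← one_mul (a k), Pi.single_mul, map_mul, hk]
      simp [u, hk]
    · simp [u, hk]
  rw [hu]
  refine (hψ u).trans ?_
  rw [← hu]
  refine (pi_norm_le_iff_of_nonneg (norm_nonneg _)).mpr fun k => ?_
  by_cases hk : ψ (Pi.single k 1) = 0
  · simp [u, hk]
  -- Injectivity of `φ` ensures that a block surviving under `ψ` also survives under `φ.comp ψ`.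
  · obtain ⟨f, v, hfv⟩ := exists_rankOne_ne_zero k
      ((φ.comp ψ : (∀ k, V k →L[ℂ] V k) →ₙₐ[ℂ] B) : (∀ k, V k →L[ℂ] V k) →+ B)
      (fun h => hk (hφ (h.trans (map_zero φ).symm)))
    simpa [u, hk] using norm_apply_le_of_rankOne_ne_zero (φ.comp ψ) hφψ k f v hfv a

end OperatorSums

/-- The canonical homomorphisms into a Banach direct limit are contractive. -/
theorem IsBanachDirectLimit.norm_le {I : Type*} [Preorder I] {B : I → Type*}
    [∀ i, NonUnitalNormedRing (B i)] [∀ i, NormedSpace ℂ (B i)]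
    {φ : ∀ ⦃i j : I⦄, i ≤ j → B i →ₙₐ[ℂ] B j}
    {A : Type*} [NonUnitalNormedRing A] [NormedSpace ℂ A] {ψ : ∀ i, B i →ₙₐ[ℂ] A}
    (h : IsBanachDirectLimit φ ψ) {i : I} {a : B i} (hφ : ‖φ (le_refl i) a‖ ≤ ‖a‖) :
    ‖ψ i a‖ ≤ ‖a‖ := by
  rw [h.norm_eq]
  exact (ciInf_le ⟨0, by rintro _ ⟨j, rfl⟩; exact norm_nonneg _⟩
    (⟨i, Set.self_mem_Ici⟩ : Set.Ici i)).trans hφ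

end LpAF

theorem mainTheorem7 (p : ℝ≥0∞) [Fact (1 ≤ p)] (hp : p ≠ ∞)
    (A : Type u) [NonUnitalNormedRing A] [NormedSpace ℂ A] [IsScalarTower ℂ A A]
    [SMulCommClass ℂ A A] [CompleteSpace A]
    (hA : LpAF.IsSpatialLpAFAlgebra.{u, v} p A) :
    LpAF.IsPIncompressible.{u, w, x} p A := by
  obtain ⟨I, _, _, _, S, ψ, hlim⟩ := hA
  intro E _ _ _ φ hφ hinj
  have hψ : ∀ i a, ‖ψ i a‖ ≤ ‖a‖ := fun i a => hlim.norm_le (S.contractive (le_refl i) a)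
  have hcont : Continuous φ :=
    AddMonoidHomClass.continuous_of_bound φ 1 fun a => by simpa using hφ a
  refine AddMonoidHomClass.isometry_of_norm φ fun a => ?_
  -- Both norms are continuous, so it suffices to compare them on the dense union of the ranges of
  -- the `ψ i`.
  refine congrFun (hcont.norm.ext_on hlim.dense continuous_norm ?_) a
  rintro _ ⟨_, ⟨i, rfl⟩, b, rfl⟩
  exact le_antisymm (hφ _) (LpAF.norm_le_norm_comp_of_injective (ψ i) (hψ i) φ hinj
    (fun c => (hφ _).trans (hψ i c)) b)
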